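/- For a positive integer $n$ let $a(n)$ and $b(n)$ be the numbers of pairs $(k,l)\in\mathbb{Z}^2$ with $k^2+15l^2=n$ and with $3k^2+5l^2=n$, respectively. Write the prime factorization of $n$ as $$n = 2^a 3^b 5^c \prod_{i=1}^r p_i^{v_i} \prod_{j=1}^s q_j^{w_j},$$ where $a,b,c,r,s\ge 0$, the $p_i$ are distinct primes with $p_i \equiv 1, 2, 4$ or $8 \pmod{15}$ and $p_i\neq 2$, and the $q_j$ are distinct primes with $q_j \equiv 7, 11, 13$ or $14 \pmod{15}$. Let $t$ be the number of odd prime factors of $n$, counted with multiplicity, that are congruent to $2$ or $8$ modulo $15$. Then $$a(n) = |a-1| \left(1 + (-1)^{a+b+c+t}\right) \prod_{i=1}^r (1+v_i) \prod_{j=1}^s \frac{1+(-1)^{w_j}}{2}$$ and $$b(n) = |a-1| \left(1 - (-1)^{a+b+c+t}\right) \prod_{i=1}^r (1+v_i) \prod_{j=1}^s \frac{1+(-1)^{w_j}}{2}.$$ -/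

import Mathlib

/-- The representations of `n` by the binary quadratic form `α k² + β l²`: all ordered pairs of
integers `(k, l)`, with signs and order counted, at which the form takes the value `n`. -/
def diagReps (α β n : ℕ) : Set (ℤ × ℤ) :=
  {x | (α : ℤ) * x.1 ^ 2 + (β : ℤ) * x.2 ^ 2 = (n : ℤ)}

/-- For positive coefficients there are only finitely many representations, so that counting them
with `Set.ncard` is meaningful. -/
theorem diagReps_finite {α β : ℕ} (hα : 0 < α) (hβ : 0 < β) (n : ℕ) :
    (diagReps α β n).Finite := by
  apply ((Set.finite_Icc (-(n : ℤ)) n).prod (Set.finite_Icc (-(n : ℤ)) n)).subset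
  rintro ⟨k, l⟩ h
  have hα' : (1 : ℤ) ≤ α := by exact_mod_cast hα
  have hβ' : (1 : ℤ) ≤ β := by exact_mod_cast hβ
  have h' : (α : ℤ) * k ^ 2 + (β : ℤ) * l ^ 2 = (n : ℤ) := h
  have hk : k ^ 2 ≤ n := by nlinarith [sq_nonneg k, sq_nonneg l]
  have hl : l ^ 2 ≤ n := by nlinarith [sq_nonneg k, sq_nonneg l]
  have key : ∀ m : ℤ, m ^ 2 ≤ n → -(n : ℤ) ≤ m ∧ m ≤ n := fun m hm =>
    abs_le.mp (by
      have h1 : |m| ≤ |m| ^ 2 := Int.le_self_sq _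
      rw [sq_abs] at h1
      exact h1.trans hm)
  exact ⟨key k hk, key l hl⟩

/-- The number of representations of `n` by the form `α k² + β l²`. -/
noncomputable def numDiagReps (α β n : ℕ) : ℕ := (diagReps α β n).ncard

/-- The number of odd prime factors of `n`, counted with multiplicity, that are congruent to
`2` or `8` modulo `15`. -/
def oddPrimeFactorCount (n : ℕ) : ℕ :=
  n.primeFactorsList.countP fun p => Odd p ∧ (p % 15 = 2 ∨ p % 15 = 8)

/-!
The representations of `n` by `k² + 15 l²` are the elements of norm `n` in `ℤ√-15`, and those by
`3 k² + 5 l²` are the elements of norm `3 n`, since `3 (3 k² + 5 l²) = (3 k)² + 15 l²`. The class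
group has order `2`, and the prime over `3` represents the nontrivial class; so for an odd split
prime `p` there is an `α` of norm `e p` with `e = 1` or `e = 3`. Thue's lemma supplies it, and
squares modulo `5` decide which of the two occurs. Both `w ↦ w α / e` and `w ↦ w (star α) / e`
carry elements of norm `e p ^ k m` to elements of norm `p ^ (k + 1) m`. Every such element is
reached, and those reached both ways are the multiples of `p`. The number of elements of norm
`p ^ k m`, for `m` prime to `p`, is therefore `k + 1` times the number of those of norm `e ^ k m`.
This yields the factor `1 + v` and, as `e = 3` for the primes counted by `oddPrimeFactorCount`,
the sign. An inert prime dividing a norm divides the element. The ring `ℤ√-15` is not maximal at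
`2`; there the same recursion, with `3 + √-15` as `α`, starts only at the exponent `2` and gives
the factor `|a - 1|`. What remains is the number of elements of norm `3 ^ j`, which is `2` or `0`
according to the parity of `j`.
-/

theorem coprime_prod_pow {ι : Type*} {f : ι → ℕ} (hf : ∀ i, (f i).Prime) (e : ι → ℕ)
    {s : Finset ι} {q : ℕ} (hq : q.Prime) (hne : ∀ i ∈ s, q ≠ f i) :
    q.Coprime (∏ i ∈ s, f i ^ e i) :=
  Nat.Coprime.prod_right fun i hi => ((Nat.coprime_primes hq (hf i)).2 (hne i hi)).pow_right _

theorem odd_prod_pow {ι : Type*} {f : ι → ℕ} (hf : ∀ i, Odd (f i)) (e : ι → ℕ) (s : Finset ι) :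
    Odd (∏ i ∈ s, f i ^ e i) :=
  Finset.prod_induction _ Odd (fun _ _ => Odd.mul) odd_one fun i _ => (hf i).pow

theorem prod_pow_ne_zero {ι : Type*} {f : ι → ℕ} (hf : ∀ i, f i ≠ 0) (e : ι → ℕ)
    (s : Finset ι) : ∏ i ∈ s, f i ^ e i ≠ 0 :=
  Finset.prod_ne_zero_iff.2 fun i _ => pow_ne_zero _ (hf i)

/-- Here `F k m` stands for the number of elements of norm `p ^ k * m`. Up to the twist by `e`, the
recurrence has characteristic polynomial `(X - 1) ^ 2`. -/
theorem eq_add_one_mul_of_recurrence {e l : ℕ} (hle : l.Coprime e) {F : ℕ → ℕ → ℕ}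
    (hF : ∀ m, F 0 (e ^ 2 * m) = F 0 m)
    (hF₁ : ∀ m, l.Coprime m → F 1 m = 2 * F 0 (e * m))
    (hF₂ : ∀ k m, l.Coprime m → F (k + 2) m + F k m = 2 * F (k + 1) (e * m))
    (k : ℕ) {m : ℕ} (hm : l.Coprime m) : F k m = (k + 1) * F 0 (e ^ k * m) := by
  induction k using Nat.twoStepInduction generalizing m with
  | zero => simp
  | one => simpa using hF₁ m hm
  | more k ih₀ ih₁ =>
    have h := hF₂ k m hm
    rw [ih₀ hm, ih₁ (hle.mul_right hm), show e ^ (k + 1) * (e * m) = e ^ 2 * (e ^ k * m) by ring,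
      hF] at h
    rw [show e ^ (k + 2) * m = e ^ 2 * (e ^ k * m) by ring, hF]
    linarith

theorem not_dvd_of_jacobiSym_ne_zero {d : ℤ} {p : ℕ} (hp : p.Prime) (h : jacobiSym d p ≠ 0) :
    ¬ (p : ℤ) ∣ d := by
  rintro hpd
  rw [jacobiSym.mod_left, Int.emod_eq_zero_of_dvd hpd, jacobiSym.zero_left hp.one_lt] at h
  exact h rfl

theorem jacobiSym_neg_of_three_mod_four {m n : ℕ} (hm : m % 4 = 3) (hn : Odd n) :
    jacobiSym (-m) n = jacobiSym n m := by
  rw [jacobiSym.neg _ hn]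
  rcases Nat.odd_mod_four_iff.1 (Nat.odd_iff.1 hn) with h | h
  · rw [ZMod.χ₄_nat_one_mod_four h, one_mul,
      jacobiSym.quadratic_reciprocity_one_mod_four'
        (Nat.odd_iff.2 (Nat.odd_of_mod_four_eq_three hm)) h]
  · rw [ZMod.χ₄_nat_three_mod_four h, jacobiSym.quadratic_reciprocity_three_mod_four hm h,
      neg_one_mul, neg_neg]

theorem thue_exists_intCast_eq_mul {n : ℕ} [NeZero n] (s : ZMod n) {A B : ℕ}
    (h : n < (A + 1) * (B + 1)) :
    ∃ x y : ℤ, (x ≠ 0 ∨ y ≠ 0) ∧ |x| ≤ A ∧ |y| ≤ B ∧ (x : ZMod n) = s * y := by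
  obtain ⟨⟨a, b⟩, hab, ⟨a', b'⟩, hab', hne, heq⟩ :=
    Finset.exists_ne_map_eq_of_card_lt_of_maps_to
      (s := Finset.range (A + 1) ×ˢ Finset.range (B + 1)) (t := (Finset.univ : Finset (ZMod n)))
      (f := fun x => (x.1 : ZMod n) - s * x.2) (by simpa [ZMod.card] using h)
      (fun _ _ => Finset.mem_univ _)
  simp only [Finset.mem_product, Finset.mem_range, ne_eq, Prod.mk.injEq] at hab hab' hne heq
  refine ⟨a - a', b - b', by lia, abs_le.2 (by lia), abs_le.2 (by lia), ?_⟩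
  push_cast
  linear_combination heq

/-! ### Elements of given norm in `ℤ√d` -/

section Zsqrtd

variable {d : ℤ}

/-- The elements of `ℤ√d` of norm `n`. For `d = -(α * β)` with `α` squarefree those of norm
`α * n` stand for the representations of `n` by `α k² + β l²`, so that the arithmetic of the
ring `ℤ√d` becomes available for counting representations. -/
def elemsOfNorm (d : ℤ) (n : ℕ) : Set (ℤ√d) := {z | z.norm = n}

theorem mem_elemsOfNorm {z : ℤ√d} {n : ℕ} : z ∈ elemsOfNorm d n ↔ z.norm = n := Iff.rfl

/-- The number of elements of `ℤ√d` of norm `n`; it is meaningful for `d < 0`, where there are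
finitely many (`elemsOfNorm_finite`), and defaults to `0` for an infinite set. -/
noncomputable def normCount (d : ℤ) (n : ℕ) : ℕ := (elemsOfNorm d n).ncard

theorem image_diagReps {α β : ℕ} (hα : Squarefree α) (hd : d = -(α * β)) (n : ℕ) :
    (fun x : ℤ × ℤ => (⟨α * x.1, x.2⟩ : ℤ√d)) '' diagReps α β n = elemsOfNorm d (α * n) := by
  have hα0 : (α : ℤ) ≠ 0 := mod_cast hα.ne_zero
  subst hd
  ext ⟨x, y⟩
  simp only [Set.mem_image, diagReps, elemsOfNorm, Set.mem_ofPred_eq, Zsqrtd.norm_def,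
    Zsqrtd.mk.injEq, Prod.exists, Nat.cast_mul]
  constructor
  · rintro ⟨k, l, h, rfl, rfl⟩
    linear_combination α * h
  · intro h
    obtain ⟨k, rfl⟩ : (α : ℤ) ∣ x :=
      ((Int.squarefree_natCast.2 hα).dvd_pow_iff_dvd two_ne_zero).1
        ⟨n - β * y ^ 2, by linear_combination h⟩
    exact ⟨k, y, mul_left_cancel₀ hα0 (by linear_combination h), rfl, rfl⟩

theorem numDiagReps_eq_normCount {α β : ℕ} (hα : Squarefree α) (hd : d = -(α * β)) (n : ℕ) :
    numDiagReps α β n = normCount d (α * n) := by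
  rw [numDiagReps, normCount, ← image_diagReps hα hd, Set.ncard_image_of_injective]
  rintro ⟨x, y⟩ ⟨x', y'⟩ h
  simpa [hα.ne_zero] using h

theorem numDiagReps_comm (α β n : ℕ) : numDiagReps α β n = numDiagReps β α n := by
  rw [numDiagReps, numDiagReps, ← Set.ncard_image_of_injective _ Prod.swap_injective,
    Set.image_swap_eq_preimage_swap]
  congr 1
  ext x
  simp [diagReps, add_comm]

theorem elemsOfNorm_finite (hd : d < 0) (n : ℕ) : (elemsOfNorm d n).Finite := by
  have h := image_diagReps (d := d) (β := d.natAbs) squarefree_one (by lia) n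
  rw [one_mul] at h
  exact h ▸ (diagReps_finite one_pos (Int.natAbs_pos.2 hd.ne) n).image _

theorem normCount_one (hd : d < -1) : normCount d 1 = 2 := by
  have : elemsOfNorm d 1 = {1, -1} := by
    ext ⟨x, y⟩
    simp only [mem_elemsOfNorm, Zsqrtd.norm_def, Nat.cast_one,
      Set.mem_insert_iff, Set.mem_singleton_iff, Zsqrtd.ext_iff, Zsqrtd.re_one, Zsqrtd.im_one,
      Zsqrtd.re_neg, Zsqrtd.im_neg, neg_zero]
    constructor
    · intro h
      obtain rfl : y = 0 := by
        by_contra hy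
        have : 0 < y ^ 2 := by positivity
        nlinarith [sq_nonneg x]
      simpa [mul_self_eq_one_iff] using h
    · rintro (⟨rfl, rfl⟩ | ⟨rfl, rfl⟩) <;> norm_num
  rw [normCount, this, Set.ncard_pair (by simp [Zsqrtd.ext_iff])]

theorem star_mem_elemsOfNorm {z : ℤ√d} {n : ℕ} :
    star z ∈ elemsOfNorm d n ↔ z ∈ elemsOfNorm d n := by
  simp [elemsOfNorm]

theorem intCast_dvd_star {k : ℤ} {z : ℤ√d} : (k : ℤ√d) ∣ star z ↔ (k : ℤ√d) ∣ z := by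
  simp [Zsqrtd.intCast_dvd]

theorem ncard_intCast_dvd {e : ℤ} (he : e ≠ 0) {m n : ℕ} (h : (n : ℤ) = e ^ 2 * m) :
    {z ∈ elemsOfNorm d n | (e : ℤ√d) ∣ z}.ncard = normCount d m := by
  have hinj : Function.Injective fun z : ℤ√d => e * z :=
    fun _ _ => Zsqrtd.eq_of_smul_eq_smul_left he
  rw [normCount, ← Set.ncard_image_of_injective (elemsOfNorm d m) hinj]
  congr 1
  ext z
  constructor
  · rintro ⟨hz, w, rfl⟩
    refine ⟨w, mul_left_cancel₀ (pow_ne_zero 2 he) ?_, rfl⟩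
    rw [← h, ← hz, Zsqrtd.norm_mul, Zsqrtd.norm_intCast, sq]
  · rintro ⟨w, hw, rfl⟩
    refine ⟨?_, dvd_mul_right _ _⟩
    rw [mem_elemsOfNorm, Zsqrtd.norm_mul, Zsqrtd.norm_intCast, hw, h, sq]

theorem normCount_sq_mul {e : ℕ} (he : e ≠ 0) {m : ℕ}
    (h : ∀ z ∈ elemsOfNorm d (e ^ 2 * m), ((e : ℤ) : ℤ√d) ∣ z) :
    normCount d (e ^ 2 * m) = normCount d m := by
  rw [← ncard_intCast_dvd (d := d) (Nat.cast_ne_zero.2 he) (Nat.cast_mul _ m),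
    Set.sep_eq_self_iff_mem_true.2 h, normCount]

theorem intCast_mul_eq_mul_iff {k l : ℤ} (hk : k ≠ 0) (hl : l ≠ 0) {α : ℤ√d}
    (hα : α.norm = k * l) (z w : ℤ√d) : k * z = w * α ↔ l * w = z * star α := by
  have hα' : α * star α = k * l := by rw [← Zsqrtd.norm_eq_mul_conj, hα, Int.cast_mul]
  constructor <;> intro h
  · apply Zsqrtd.eq_of_smul_eq_smul_left hk
    linear_combination -star α * h - w * hα'
  · apply Zsqrtd.eq_of_smul_eq_smul_left hl
    linear_combination -α * h - z * hα'

theorem mem_elemsOfNorm_iff_of_mul_eq_mul {n n' : ℕ} {k l : ℤ} (hk : k ≠ 0) (hl : l ≠ 0)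
    {α : ℤ√d} (hα : α.norm = k * l) (hn : n * k = n' * l) {z w : ℤ√d} (h : k * z = w * α) :
    z ∈ elemsOfNorm d n ↔ w ∈ elemsOfNorm d n' := by
  have hzw : k * z.norm = l * w.norm := by
    apply mul_left_cancel₀ hk
    have := congrArg Zsqrtd.norm h
    rw [Zsqrtd.norm_mul, Zsqrtd.norm_mul, Zsqrtd.norm_intCast, hα] at this
    linear_combination this
  simp only [mem_elemsOfNorm]
  rw [← mul_right_inj' hk, hzw, mul_comm k, hn, mul_comm _ l, mul_right_inj' hl]

/-- Both sides count the pairs `(z, w)` with `k z = w α`, or equivalently `l w = z (star α)`. -/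
theorem ncard_dvd_mul_star {n n' : ℕ} {k l : ℤ} (hk : k ≠ 0) (hl : l ≠ 0) {α : ℤ√d}
    (hα : α.norm = k * l) (hn : n * k = n' * l) :
    {z ∈ elemsOfNorm d n | (l : ℤ√d) ∣ z * star α}.ncard =
      {w ∈ elemsOfNorm d n' | (k : ℤ√d) ∣ w * α}.ncard := by
  have hα0 : α.norm ≠ 0 := hα ▸ mul_ne_zero hk hl
  have hiff := intCast_mul_eq_mul_iff hk hl hα
  have hk_inj : Function.Injective fun z : ℤ√d => k * z :=
    fun _ _ => Zsqrtd.eq_of_smul_eq_smul_left hk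
  have hα_inj : Function.Injective fun w : ℤ√d => w * α := fun w w' h =>
    Zsqrtd.eq_of_smul_eq_smul_left hα0 (by
      rw [Zsqrtd.norm_eq_mul_conj]; linear_combination star α * h)
  rw [← Set.ncard_image_of_injective _ hk_inj,
    ← Set.ncard_image_of_injective {w ∈ elemsOfNorm d n' | (k : ℤ√d) ∣ w * α} hα_inj]
  congr 1
  ext x
  constructor
  · rintro ⟨z, ⟨hz, w, hw⟩, rfl⟩
    have h := (hiff z w).2 hw.symm
    exact ⟨w, ⟨(mem_elemsOfNorm_iff_of_mul_eq_mul hk hl hα hn h).1 hz, z, h.symm⟩, h.symm⟩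
  · rintro ⟨w, ⟨hw, z, hz⟩, rfl⟩
    have h := hz.symm
    exact ⟨z, ⟨(mem_elemsOfNorm_iff_of_mul_eq_mul hk hl hα hn h).2 hw, w, ((hiff z w).1 h).symm⟩, h⟩

/-- Each of the two divisibility conditions in `hsplit` cuts out `normCount d n'` elements; the
elements satisfying both are the multiples of `e`. -/
theorem normCount_add_ncard_dvd (hd : d < 0) {n n' : ℕ} {k l e : ℤ} (hk : k ≠ 0) (hl : l ≠ 0)
    {α : ℤ√d} (hα : α.norm = k * l) (hn : n * k = n' * l)
    (hdvd : ∀ w ∈ elemsOfNorm d n', (k : ℤ√d) ∣ w * α)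
    (hsplit : ∀ z ∈ elemsOfNorm d n, (l : ℤ√d) ∣ z * star α ∨ (l : ℤ√d) ∣ z * α)
    (hboth : ∀ z ∈ elemsOfNorm d n,
      ((l : ℤ√d) ∣ z * star α ∧ (l : ℤ√d) ∣ z * α) ↔ (e : ℤ√d) ∣ z) :
    normCount d n + {z ∈ elemsOfNorm d n | (e : ℤ√d) ∣ z}.ncard = 2 * normCount d n' := by
  set A := {z ∈ elemsOfNorm d n | (l : ℤ√d) ∣ z * star α}
  set B := {z ∈ elemsOfNorm d n | (l : ℤ√d) ∣ z * α}
  have hunion : A ∪ B = elemsOfNorm d n := by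
    rw [← Set.sep_or, Set.sep_eq_self_iff_mem_true.2 hsplit]
  have hinter : A ∩ B = {z ∈ elemsOfNorm d n | (e : ℤ√d) ∣ z} := by
    rw [← Set.sep_and]
    exact Set.sep_ext_iff.2 hboth
  have hA : A.ncard = normCount d n' := by
    rw [ncard_dvd_mul_star hk hl hα hn, Set.sep_eq_self_iff_mem_true.2 hdvd, normCount]
  have hB : B.ncard = normCount d n' := by
    have hdvd' : ∀ w ∈ elemsOfNorm d n', (k : ℤ√d) ∣ w * star α := fun w hw => by
      rw [← intCast_dvd_star, star_mul', star_star]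
      exact hdvd _ (star_mem_elemsOfNorm.2 hw)
    have h := ncard_dvd_mul_star hk hl ((Zsqrtd.norm_conj α).trans hα) hn
    rw [star_star] at h
    rw [h, Set.sep_eq_self_iff_mem_true.2 hdvd', normCount]
  have hfin := elemsOfNorm_finite hd n
  rw [← hinter, normCount, ← hunion, Set.ncard_union_add_ncard_inter A B
    (hfin.subset (Set.sep_subset _ _)) (hfin.subset (Set.sep_subset _ _)), hA, hB, two_mul]

theorem intCast_dvd_of_dvd_norm_of_dvd_im {p : ℤ} (hp : Prime p) {z : ℤ√d} (h : p ∣ z.norm)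
    (him : p ∣ z.im) : (p : ℤ√d) ∣ z := by
  refine (Zsqrtd.intCast_dvd _ _).2 ⟨hp.dvd_of_dvd_pow (n := 2) ?_, him⟩
  rw [show z.re ^ 2 = z.norm + d * z.im * z.im by rw [Zsqrtd.norm_def]; ring]
  exact dvd_add h (him.mul_left _)

theorem intCast_dvd_of_dvd_norm_of_dvd_re {p : ℤ} (hp : Prime p) (hpd : ¬ p ∣ d) {z : ℤ√d}
    (h : p ∣ z.norm) (hre : p ∣ z.re) : (p : ℤ√d) ∣ z := by
  refine (Zsqrtd.intCast_dvd _ _).2 ⟨hre, hp.dvd_of_dvd_pow (n := 2) ?_⟩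
  refine (hp.dvd_or_dvd ?_).resolve_left hpd
  rw [show d * z.im ^ 2 = z.re * z.re - z.norm by rw [Zsqrtd.norm_def]; ring]
  exact dvd_sub (hre.mul_left _) h

theorem intCast_dvd_mul_star_or_dvd_mul {p : ℤ} (hp : Prime p) {z α : ℤ√d}
    (hz : p ∣ z.norm) (hα : p ∣ α.norm) : (p : ℤ√d) ∣ z * star α ∨ (p : ℤ√d) ∣ z * α := by
  have him : p ∣ (z * star α).im * (z * α).im := by
    rw [show (z * star α).im * (z * α).im = z.im ^ 2 * α.norm - α.im ^ 2 * z.norm by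
      simp only [Zsqrtd.norm_def, Zsqrtd.im_mul, Zsqrtd.re_star, Zsqrtd.im_star]; ring]
    exact dvd_sub (hα.mul_left _) (hz.mul_left _)
  refine (hp.dvd_or_dvd him).imp ?_ ?_ <;>
    exact intCast_dvd_of_dvd_norm_of_dvd_im hp (by rw [Zsqrtd.norm_mul]; exact hz.mul_right _)

theorem intCast_dvd_of_dvd_mul_star_of_dvd_mul {p : ℤ} (hp : Prime p) {z α : ℤ√d}
    (hα : ¬ p ∣ 2 * α.re) (h₁ : (p : ℤ√d) ∣ z * star α) (h₂ : (p : ℤ√d) ∣ z * α) :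
    (p : ℤ√d) ∣ z := by
  have h : (p : ℤ√d) ∣ ((2 * α.re : ℤ) : ℤ√d) * z := by
    convert dvd_add h₁ h₂ using 1
    ext <;> simp <;> ring
  rw [Zsqrtd.intCast_dvd, Zsqrtd.re_smul, Zsqrtd.im_smul] at h
  exact (Zsqrtd.intCast_dvd _ _).2
    ⟨(hp.dvd_or_dvd h.1).resolve_left hα, (hp.dvd_or_dvd h.2).resolve_left hα⟩

theorem dvd_re_of_dvd_norm {p : ℤ} (hp : Prime p) (hpd : p ∣ d) {z : ℤ√d} (h : p ∣ z.norm) :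
    p ∣ z.re := by
  refine hp.dvd_of_dvd_pow (n := 2) ?_
  rw [show z.re ^ 2 = z.norm + d * (z.im * z.im) by rw [Zsqrtd.norm_def]; ring]
  exact dvd_add h (hpd.mul_right _)

theorem intCast_dvd_mul_of_dvd_norm {p : ℤ} (hp : Prime p) (hpd : p ∣ d) {z w : ℤ√d}
    (hz : p ∣ z.norm) (hw : p ∣ w.norm) : (p : ℤ√d) ∣ z * w := by
  have hz' := dvd_re_of_dvd_norm hp hpd hz
  have hw' := dvd_re_of_dvd_norm hp hpd hw
  rw [Zsqrtd.intCast_dvd, Zsqrtd.re_mul, Zsqrtd.im_mul, mul_assoc d]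
  exact ⟨dvd_add (hz'.mul_right _) (hpd.mul_right _), dvd_add (hz'.mul_right _) (hw'.mul_left _)⟩

theorem intCast_dvd_of_sq_dvd_norm {p : ℤ} (hp : Prime p) (hpd : p ∣ d) (hpd' : ¬ p ^ 2 ∣ d)
    {z : ℤ√d} (h : p ^ 2 ∣ z.norm) : (p : ℤ√d) ∣ z := by
  have hre := dvd_re_of_dvd_norm hp hpd ((dvd_pow_self p two_ne_zero).trans h)
  refine (Zsqrtd.intCast_dvd _ _).2 ⟨hre, ?_⟩
  have him : p ^ 2 ∣ d * z.im ^ 2 := by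
    rw [show d * z.im ^ 2 = z.re ^ 2 - z.norm by rw [Zsqrtd.norm_def]; ring]
    exact dvd_sub (pow_dvd_pow_of_dvd hre 2) h
  by_contra hpim
  exact hpd' (hp.pow_dvd_of_dvd_mul_right 2 (fun h => hpim (hp.dvd_of_dvd_pow h)) him)

theorem intCast_dvd_of_jacobiSym_eq_neg_one {p : ℕ} (hp : p.Prime) (hpd : jacobiSym d p = -1)
    {z : ℤ√d} (h : (p : ℤ) ∣ z.norm) : ((p : ℤ) : ℤ√d) ∣ z := by
  have := Fact.mk hp
  rw [Zsqrtd.intCast_dvd]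
  refine jacobiSym.prime_dvd_of_eq_neg_one hpd ?_
  rwa [sq, sq, ← mul_assoc, ← Zsqrtd.norm_def]

theorem not_intCast_dvd_of_mem_elemsOfNorm {p : ℕ} (hp : p.Prime) {m : ℕ} (hm : p.Coprime m)
    {z : ℤ√d} (hz : z ∈ elemsOfNorm d (p * m)) : ¬ ((p : ℤ) : ℤ√d) ∣ z := by
  rintro ⟨w, rfl⟩
  refine (hp.coprime_iff_not_dvd.1 hm) (Int.natCast_dvd_natCast.1 ⟨w.norm, ?_⟩)
  apply mul_left_cancel₀ (Int.natCast_ne_zero.2 hp.ne_zero)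
  rw [mem_elemsOfNorm, Zsqrtd.norm_mul, Zsqrtd.norm_intCast, Nat.cast_mul] at hz
  linear_combination -hz

theorem normCount_inert_pow_mul {p : ℕ} (hp : p.Prime) (hpd : jacobiSym d p = -1) (k : ℕ)
    {m : ℕ} (hm : p.Coprime m) :
    (normCount d (p ^ k * m) : ℚ) = (1 + (-1) ^ k) / 2 * normCount d m := by
  have hdvd : ∀ n, ∀ z ∈ elemsOfNorm d (p * n), ((p : ℤ) : ℤ√d) ∣ z := fun n z hz =>
    intCast_dvd_of_jacobiSym_eq_neg_one hp hpd (hz ▸ by simp)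
  induction k using Nat.twoStepInduction with
  | zero => norm_num
  | one =>
    have hempty : elemsOfNorm d (p ^ 1 * m) = ∅ := by
      rw [pow_one]
      exact Set.eq_empty_of_forall_notMem fun z hz =>
        not_intCast_dvd_of_mem_elemsOfNorm hp hm hz (hdvd m z hz)
    rw [normCount, hempty, Set.ncard_empty]
    norm_num
  | more k ih _ =>
    rw [show p ^ (k + 2) * m = p ^ 2 * (p ^ k * m) by ring, normCount_sq_mul hp.ne_zero, ih]
    · ring
    · rw [sq, mul_assoc]
      exact hdvd _

theorem normCount_prod_inert_pow_mul {ι : Type*} {q : ι → ℕ} (hq : ∀ j, (q j).Prime)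
    (hq_inj : Function.Injective q) (hqd : ∀ j, jacobiSym d (q j) = -1) (w : ι → ℕ)
    (s : Finset ι) {m : ℕ} (hm : ∀ j ∈ s, (q j).Coprime m) :
    (normCount d ((∏ j ∈ s, q j ^ w j) * m) : ℚ) =
      (∏ j ∈ s, ((1 + (-1) ^ w j) / 2)) * normCount d m := by
  classical
  induction s using Finset.induction_on with
  | empty => simp
  | insert j s hj ih =>
    rw [Finset.forall_mem_insert] at hm
    rw [Finset.prod_insert hj, Finset.prod_insert hj, mul_assoc, mul_assoc,
      normCount_inert_pow_mul (hq j) (hqd j), ih hm.2]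
    exact (coprime_prod_pow hq w (hq j) fun i hi h => hj (hq_inj h ▸ hi)).mul_right hm.1

/-- The ideals `(p, α)` and `(p, star α)` are the two distinct primes over `p`. -/
theorem normCount_prime_mul_add_ncard_dvd (hd : d < 0) {p : ℕ} (hp : p.Prime) (hp2 : p ≠ 2)
    (hpd : ¬ (p : ℤ) ∣ d) {k : ℕ} (hpk : p.Coprime k) {α : ℤ√d} (hα : α.norm = k * p)
    (hdvd : ∀ w : ℤ√d, (k : ℤ) ∣ w.norm → ((k : ℤ) : ℤ√d) ∣ w * α) (m : ℕ) :
    normCount d (p * m) + {z ∈ elemsOfNorm d (p * m) | ((p : ℤ) : ℤ√d) ∣ z}.ncard =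
      2 * normCount d (k * m) := by
  have hp' := Nat.prime_iff_prime_int.1 hp
  have hk : (k : ℤ) ≠ 0 := by
    rintro hk
    exact hp.ne_one (by simpa [Int.natCast_eq_zero.1 hk] using hpk)
  have hpα : ¬ ((p : ℤ) : ℤ√d) ∣ α :=
    not_intCast_dvd_of_mem_elemsOfNorm hp hpk (by
      rw [mem_elemsOfNorm, hα, mul_comm, Nat.cast_mul])
  have hre : ¬ (p : ℤ) ∣ 2 * α.re := by
    rw [hp'.dvd_mul, not_or]
    refine ⟨fun h => hp2 ?_, fun h => hpα ?_⟩
    · exact (Nat.prime_dvd_prime_iff_eq hp Nat.prime_two).1 (mod_cast h)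
    · exact intCast_dvd_of_dvd_norm_of_dvd_re hp' hpd (hα ▸ dvd_mul_left _ _) h
  refine normCount_add_ncard_dvd hd hk hp'.ne_zero hα (by push_cast; ring)
    (fun w hw => hdvd w (hw ▸ by simp)) (fun z hz => ?_)
    fun z _ => ⟨fun h => ?_, fun h => ⟨h.mul_right _, h.mul_right _⟩⟩
  · refine intCast_dvd_mul_star_or_dvd_mul hp' ?_ (hα ▸ dvd_mul_left _ _)
    exact hz ▸ by simp
  · exact intCast_dvd_of_dvd_mul_star_of_dvd_mul hp' hre h.1 h.2

theorem normCount_split_pow_mul (hd : d < 0) {p : ℕ} (hp : p.Prime) (hp2 : p ≠ 2)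
    (hpd : ¬ (p : ℤ) ∣ d) {e : ℕ} (hpe : p.Coprime e)
    (he : ∀ m, normCount d (e ^ 2 * m) = normCount d m) {α : ℤ√d} (hα : α.norm = e * p)
    (hdvd : ∀ w : ℤ√d, (e : ℤ) ∣ w.norm → ((e : ℤ) : ℤ√d) ∣ w * α) (k : ℕ) {m : ℕ}
    (hm : p.Coprime m) : normCount d (p ^ k * m) = (k + 1) * normCount d (e ^ k * m) := by
  have hcount := normCount_prime_mul_add_ncard_dvd hd hp hp2 hpd hpe hα hdvd
  have h := eq_add_one_mul_of_recurrence (F := fun k m => normCount d (p ^ k * m)) hpe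
    (fun m => by simpa using he m) (fun m hm => ?_) (fun k m _ => ?_) k hm
  · simpa using h
  · have hempty : {z ∈ elemsOfNorm d (p * m) | ((p : ℤ) : ℤ√d) ∣ z} = ∅ :=
      Set.sep_eq_empty_iff_mem_false.2 fun z => not_intCast_dvd_of_mem_elemsOfNorm hp hm
    have h := hcount m
    rw [hempty, Set.ncard_empty, add_zero] at h
    simpa using h
  · have h := hcount (p ^ (k + 1) * m)
    rw [ncard_intCast_dvd (m := p ^ k * m) (Nat.cast_ne_zero.2 hp.ne_zero)
      (by push_cast; ring)] at h
    rw [show p ^ (k + 2) * m = p * (p ^ (k + 1) * m) by ring, h, mul_left_comm e]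

theorem two_dvd_re_add_im (hd : Odd d) {z : ℤ√d} (h : 2 ∣ z.norm) :
    2 ∣ z.re + z.im := by
  rw [← even_iff_two_dvd, Zsqrtd.norm_def] at *
  have := Int.not_even_iff_odd.2 hd
  simp only [Int.even_add, Int.even_sub, Int.even_mul, this] at *
  tauto

theorem four_dvd_re_add_im (hd : Odd d) {z : ℤ√d} (hz : ((2 : ℤ) : ℤ√d) ∣ z)
    (h : 8 ∣ z.norm) : 4 ∣ z.re + z.im := by
  obtain ⟨w, rfl⟩ := hz
  rw [Zsqrtd.norm_mul, Zsqrtd.norm_intCast] at h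
  have hw := two_dvd_re_add_im hd (z := w) (by lia)
  rw [Zsqrtd.re_smul, Zsqrtd.im_smul]
  lia

/-- If both coordinates are odd, then the norm is congruent to `1 - d` modulo `8`. -/
theorem two_dvd_of_not_eight_dvd_norm (hd : d % 8 = 1) {z : ℤ√d} (h : 2 ∣ z.norm)
    (h' : ¬ 8 ∣ z.norm) : ((2 : ℤ) : ℤ√d) ∣ z := by
  have hsum := two_dvd_re_add_im (Int.odd_iff.2 (by lia)) h
  rw [Zsqrtd.intCast_dvd]
  by_cases hre : 2 ∣ z.re
  · exact ⟨hre, (dvd_add_right hre).1 hsum⟩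
  · refine absurd ?_ h'
    rw [show z.norm = (z.re ^ 2 - 1) - d * (z.im ^ 2 - 1) - (d - 1) by
      rw [Zsqrtd.norm_def]; ring]
    have hre₈ := Int.eight_dvd_sq_sub_one_of_odd (k := z.re) (Int.odd_iff.2 (by lia))
    have him₈ := Int.eight_dvd_sq_sub_one_of_odd (k := z.im) (Int.odd_iff.2 (by lia))
    exact dvd_sub (dvd_sub hre₈ (him₈.mul_left d)) (by lia)

theorem normCount_two_mul_of_odd (hd : d % 8 = 1) {m : ℕ} (hm : Odd m) :
    normCount d (2 * m) = 0 := by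
  have hempty : elemsOfNorm d (2 * m) = ∅ := Set.eq_empty_of_forall_notMem fun z hz => by
    refine not_intCast_dvd_of_mem_elemsOfNorm Nat.prime_two (Nat.coprime_two_left.2 hm) hz ?_
    have hnorm : z.norm = 2 * m := by simpa [mem_elemsOfNorm] using hz
    obtain ⟨c, rfl⟩ := hm
    exact two_dvd_of_not_eight_dvd_norm hd (by lia) (by lia)
  rw [normCount, hempty, Set.ncard_empty]

theorem normCount_four_mul_of_odd (hd : d % 8 = 1) {m : ℕ} (hm : Odd m) :
    normCount d (4 * m) = normCount d m :=
  normCount_sq_mul two_ne_zero fun z hz => by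
    have hnorm : z.norm = 4 * m := by simpa [mem_elemsOfNorm] using hz
    obtain ⟨c, rfl⟩ := hm
    exact two_dvd_of_not_eight_dvd_norm hd (by lia) (by lia)

end Zsqrtd

/-! ### Norms in `ℤ√-15` -/

theorem normCount_nine_mul (m : ℕ) : normCount (-15) (3 ^ 2 * m) = normCount (-15) m :=
  normCount_sq_mul three_ne_zero fun z hz =>
    intCast_dvd_of_sq_dvd_norm Int.prime_three (by norm_num) (by norm_num) (hz ▸ by simp)

theorem normCount_three_pow_sq_mul (j m : ℕ) :
    normCount (-15) ((3 ^ j) ^ 2 * m) = normCount (-15) m := by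
  induction j with
  | zero => simp
  | succ j ih =>
    rw [show (3 ^ (j + 1)) ^ 2 * m = 3 ^ 2 * ((3 ^ j) ^ 2 * m) by ring, normCount_nine_mul, ih]

theorem numDiagReps_one_fifteen (n : ℕ) : numDiagReps 1 15 n = normCount (-15) n := by
  rw [numDiagReps_eq_normCount (d := -15) squarefree_one (by norm_num), one_mul]

theorem numDiagReps_three_five (n : ℕ) : numDiagReps 3 5 n = normCount (-15) (3 * n) :=
  numDiagReps_eq_normCount Nat.prime_three.prime.squarefree (by norm_num) n

theorem normCount_five_mul (n : ℕ) : normCount (-15) (5 * n) = normCount (-15) (3 * n) := by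
  rw [← numDiagReps_three_five, numDiagReps_comm,
    numDiagReps_eq_normCount (d := -15) Nat.prime_five.prime.squarefree (by norm_num)]

theorem normCount_five_pow_mul (c n : ℕ) :
    normCount (-15) (5 ^ c * n) = normCount (-15) (3 ^ c * n) := by
  induction c generalizing n with
  | zero => simp
  | succ c ih =>
    rw [pow_succ', mul_assoc, normCount_five_mul, mul_left_comm, ih, pow_succ, mul_assoc]

theorem norm_emod_five (z : ℤ√(-15)) : z.norm % 5 = 0 ∨ z.norm % 5 = 1 ∨ z.norm % 5 = 4 := by
  have h : z.norm % 5 = (z.re % 5) * (z.re % 5) % 5 := by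
    rw [← Int.mul_emod, Zsqrtd.norm_def]
    lia
  have h₀ := Int.emod_nonneg z.re (by norm_num : (5 : ℤ) ≠ 0)
  have h₁ := Int.emod_lt_of_pos z.re (by norm_num : (0 : ℤ) < 5)
  rw [h]
  interval_cases z.re % 5 <;> norm_num

theorem normCount_three_pow (j : ℕ) : (normCount (-15) (3 ^ j) : ℚ) = 1 + (-1) ^ j := by
  induction j using Nat.twoStepInduction with
  | zero => norm_num [normCount_one]
  | one =>
    have hempty : elemsOfNorm (-15) (3 ^ 1) = ∅ :=
      Set.eq_empty_of_forall_notMem fun z (hz : z.norm = 3) => by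
        have := norm_emod_five z
        lia
    rw [normCount, hempty, Set.ncard_empty]
    norm_num
  | more j ih _ =>
    rw [pow_add, mul_comm, normCount_nine_mul, ih]
    ring

/-- In the maximal order, `3 + √-15` is divisible by the square of one prime over `2` and by the
other prime only once. -/
theorem normCount_eight_mul_add (m : ℕ) :
    normCount (-15) (8 * m) + normCount (-15) (2 * m) = 2 * normCount (-15) (12 * m) := by
  have hd : Odd (-15 : ℤ) := by decide
  rw [← normCount_add_ncard_dvd (n := 8 * m) (n' := 12 * m) (α := ⟨3, 1⟩) (k := 6) (l := 4)
      (e := 2) (by norm_num) (by norm_num) (by norm_num) (by norm_num [Zsqrtd.norm_def])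
      (by push_cast; ring),
    ncard_intCast_dvd (m := 2 * m) two_ne_zero (by push_cast; ring)]
  all_goals
    intro z hz
    replace hz : z.norm = _ := hz
    push_cast at hz
    have hsum := two_dvd_re_add_im hd (z := z) (by lia)
    simp only [Zsqrtd.intCast_dvd, Zsqrtd.re_mul, Zsqrtd.im_mul, Zsqrtd.re_star, Zsqrtd.im_star]
  · have hre := dvd_re_of_dvd_norm Int.prime_three (by norm_num) (z := z) (by lia)
    lia
  all_goals
    have hfour : 2 ∣ z.re → 4 ∣ z.re + z.im := fun hre =>
      four_dvd_re_add_im hd ((Zsqrtd.intCast_dvd _ _).2 (by lia)) (by lia)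
    lia

theorem normCount_two_pow_mul (a : ℕ) {m : ℕ} (hm : Odd m) :
    (normCount (-15) (2 ^ a * m) : ℚ) = |(a : ℚ) - 1| * normCount (-15) (3 ^ a * m) := by
  match a with
  | 0 => simp
  | 1 => simp [normCount_two_mul_of_odd (d := -15) rfl hm]
  | k + 2 =>
    have hrec := eq_add_one_mul_of_recurrence (l := 2) (e := 3)
      (F := fun k m => normCount (-15) (2 ^ (k + 2) * m)) (by norm_num)
      (fun m => ?_) (fun m hm => ?_) (fun k m _ => ?_) k (Nat.coprime_two_left.2 hm)
    · have hm' : Odd (3 ^ k * m) := Odd.mul (Odd.pow (by decide)) hm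
      rw [hrec, show 3 ^ (k + 2) * m = 3 ^ 2 * (3 ^ k * m) by ring, normCount_nine_mul,
        show 2 ^ (0 + 2) * (3 ^ k * m) = 4 * (3 ^ k * m) by ring,
        normCount_four_mul_of_odd rfl hm', abs_of_nonneg (by push_cast; linarith)]
      push_cast
      ring
    · rw [show 2 ^ (0 + 2) * (3 ^ 2 * m) = 3 ^ 2 * (2 ^ (0 + 2) * m) by ring, normCount_nine_mul]
    · have h := normCount_eight_mul_add m
      rw [normCount_two_mul_of_odd rfl (Nat.coprime_two_left.1 hm), add_zero] at h
      rw [show 2 ^ (1 + 2) * m = 8 * m by ring, h, show 12 * m = 2 ^ (0 + 2) * (3 * m) by ring]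
    · have h := normCount_eight_mul_add (2 ^ (k + 1) * m)
      convert h using 3 <;> ring

theorem jacobiSym_neg_fifteen {n : ℕ} (hn : Odd n) :
    jacobiSym (-15) n = jacobiSym (n % 15 : ℕ) 15 := by
  rw [Int.natCast_mod, ← jacobiSym.mod_left]
  exact jacobiSym_neg_of_three_mod_four (m := 15) rfl hn

theorem jacobiSym_neg_fifteen_eq_one_iff {n : ℕ} (hn : Odd n) :
    jacobiSym (-15) n = 1 ↔ n % 15 = 1 ∨ n % 15 = 2 ∨ n % 15 = 4 ∨ n % 15 = 8 := by
  rw [jacobiSym_neg_fifteen hn]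
  have : n % 15 < 15 := Nat.mod_lt _ (by norm_num)
  interval_cases n % 15 <;> norm_num

theorem jacobiSym_neg_fifteen_eq_neg_one_iff {n : ℕ} (hn : Odd n) :
    jacobiSym (-15) n = -1 ↔ n % 15 = 7 ∨ n % 15 = 11 ∨ n % 15 = 13 ∨ n % 15 = 14 := by
  rw [jacobiSym_neg_fifteen hn]
  have : n % 15 < 15 := Nat.mod_lt _ (by norm_num)
  interval_cases n % 15 <;> norm_num

theorem exists_norm_eq_mul_of_isSquare {p : ℕ} (hp : p ≠ 0) (h : IsSquare ((-15 : ℤ) : ZMod p)) :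
    ∃ (z : ℤ√(-15)) (k : ℕ), 0 < k ∧ k < 8 ∧ z.norm = k * p := by
  have := NeZero.mk hp
  obtain ⟨s, hs⟩ := h
  set A := Nat.sqrt (4 * p)
  set B := Nat.sqrt (p / 4)
  have hA : A * A ≤ 4 * p := Nat.sqrt_le _
  have hB : B * B ≤ p / 4 := Nat.sqrt_le _
  have hAB : p < (A + 1) * (B + 1) := by
    have hA' : 4 * p < (A + 1) * (A + 1) := Nat.lt_succ_sqrt _
    have hB' : p / 4 < (B + 1) * (B + 1) := Nat.lt_succ_sqrt _
    have hmul := Nat.mul_lt_mul'' hA' (show p < 4 * ((B + 1) * (B + 1)) by lia)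
    refine lt_of_mul_self_lt_mul_self₀ (by positivity) ?_
    linarith
  obtain ⟨x, y, hxy, hx, hy, hxs⟩ := thue_exists_intCast_eq_mul s hAB
  obtain ⟨k, hk⟩ : (p : ℤ) ∣ x ^ 2 + 15 * y ^ 2 := by
    rw [← ZMod.intCast_zmod_eq_zero_iff_dvd]
    push_cast at hs ⊢
    rw [hxs]
    linear_combination -(y : ZMod p) ^ 2 * hs
  have hpos : 0 < x ^ 2 + 15 * y ^ 2 := by
    rcases hxy with hx0 | hy0 <;> positivity
  have hlt : x ^ 2 + 15 * y ^ 2 < 8 * p := by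
    have hx2 : x ^ 2 ≤ A * A := by simpa [sq] using mul_self_le_mul_self (abs_nonneg x) hx
    have hy2 : y ^ 2 ≤ B * B := by simpa [sq] using mul_self_le_mul_self (abs_nonneg y) hy
    lia
  rw [hk] at hpos hlt
  have hp' : (0 : ℤ) < p := by positivity
  lift k to ℕ using (pos_of_mul_pos_right hpos hp'.le).le
  refine ⟨⟨x, y⟩, k, ?_, ?_, ?_⟩
  · exact_mod_cast pos_of_mul_pos_right hpos hp'.le
  · rw [mul_comm] at hlt
    exact_mod_cast lt_of_mul_lt_mul_right hlt hp'.le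
  · rw [Zsqrtd.norm_def]
    linear_combination hk

theorem exists_norm_eq_or_eq_three_mul {p : ℕ} (hp : p.Prime) (hp2 : p ≠ 2)
    (hsplit : jacobiSym (-15) p = 1) :
    ∃ α : ℤ√(-15), α.norm = p ∨ α.norm = 3 * p := by
  have := Fact.mk hp
  obtain ⟨c, hc⟩ := hp.odd_of_ne_two hp2
  obtain ⟨z, k, hk₀, hk₈, hz⟩ :=
    exists_norm_eq_mul_of_isSquare hp.ne_zero (ZMod.isSquare_of_jacobiSym_eq_one hsplit)
  obtain ⟨j, rfl | rfl⟩ := Nat.even_or_odd' k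
  · obtain rfl | rfl | rfl : j = 1 ∨ j = 2 ∨ j = 3 := by lia
    all_goals
      obtain ⟨w, rfl⟩ := two_dvd_of_not_eight_dvd_norm rfl (z := z) (by lia) (by lia)
      rw [Zsqrtd.norm_mul, Zsqrtd.norm_intCast] at hz
      exact ⟨w, Or.inl (by lia)⟩
  obtain rfl | rfl | rfl | rfl : j = 0 ∨ j = 1 ∨ j = 2 ∨ j = 3 := by lia
  · exact ⟨z, Or.inl (by simpa using hz)⟩
  · exact ⟨z, Or.inr (by simpa using hz)⟩
  · obtain ⟨u, hu⟩ := dvd_re_of_dvd_norm (Int.prime_ofNat_iff.2 Nat.prime_five) (by norm_num)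
      (hz ▸ dvd_mul_right _ _)
    refine ⟨⟨3 * z.im, u⟩, Or.inr ?_⟩
    rw [Zsqrtd.norm_def, hu] at hz
    rw [Zsqrtd.norm_def]
    push_cast at hz
    linarith
  · have hinert : jacobiSym (-15) 7 = -1 := by norm_num
    have hz7 := intCast_dvd_of_jacobiSym_eq_neg_one (by norm_num) hinert
      (hz ▸ dvd_mul_right _ _)
    have hp7 : ¬ Nat.Coprime 7 p := fun h =>
      not_intCast_dvd_of_mem_elemsOfNorm (by norm_num) h (by simpa [mem_elemsOfNorm] using hz) hz7
    rw [Nat.coprime_primes (by norm_num) hp, not_not] at hp7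
    rw [← hp7, hinert] at hsplit
    norm_num at hsplit

theorem oddPrimeFactorCount_mul {m n : ℕ} (hm : m ≠ 0) (hn : n ≠ 0) :
    oddPrimeFactorCount (m * n) = oddPrimeFactorCount m + oddPrimeFactorCount n := by
  rw [oddPrimeFactorCount, (Nat.perm_primeFactorsList_mul hm hn).countP_eq, List.countP_append,
    oddPrimeFactorCount, oddPrimeFactorCount]

theorem oddPrimeFactorCount_prime {p : ℕ} (hp : p.Prime) :
    oddPrimeFactorCount p = if Odd p ∧ (p % 15 = 2 ∨ p % 15 = 8) then 1 else 0 := by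
  rw [oddPrimeFactorCount, Nat.primeFactorsList_prime hp, List.countP_singleton]
  simp only [decide_eq_true_eq]

theorem oddPrimeFactorCount_pow {m : ℕ} (hm : m ≠ 0) (k : ℕ) :
    oddPrimeFactorCount (m ^ k) = k * oddPrimeFactorCount m := by
  induction k with
  | zero => simp [oddPrimeFactorCount]
  | succ k ih => rw [pow_succ, oddPrimeFactorCount_mul (pow_ne_zero k hm) hm, ih, Nat.succ_mul]

theorem oddPrimeFactorCount_prod_pow {ι : Type*} {f : ι → ℕ} (hf : ∀ i, f i ≠ 0) (e : ι → ℕ)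
    (s : Finset ι) :
    oddPrimeFactorCount (∏ i ∈ s, f i ^ e i) = ∑ i ∈ s, e i * oddPrimeFactorCount (f i) := by
  classical
  induction s using Finset.induction_on with
  | empty => simp [oddPrimeFactorCount]
  | insert i s hi ih =>
    rw [Finset.prod_insert hi, Finset.sum_insert hi,
      oddPrimeFactorCount_mul (pow_ne_zero _ (hf i)) (prod_pow_ne_zero hf e s),
      oddPrimeFactorCount_pow (hf i), ih]

theorem oddPrimeFactorCount_inert {q : ℕ} (hq : q.Prime) (hinert : jacobiSym (-15) q = -1) :
    oddPrimeFactorCount q = 0 := by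
  rw [oddPrimeFactorCount_prime hq, if_neg]
  rintro ⟨hodd, hmod⟩
  rw [jacobiSym_neg_fifteen_eq_neg_one_iff hodd] at hinert
  lia

theorem oddPrimeFactorCount_factored {ι κ : Type*} [Fintype ι] [Fintype κ] {p : ι → ℕ}
    {q : κ → ℕ} (hp : ∀ i, p i ≠ 0) (hq : ∀ j, (q j).Prime)
    (hinert : ∀ j, jacobiSym (-15) (q j) = -1) (a b c : ℕ) (v : ι → ℕ) (w : κ → ℕ) :
    oddPrimeFactorCount (2 ^ a * 3 ^ b * 5 ^ c * (∏ i, p i ^ v i) * ∏ j, q j ^ w j) =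
      ∑ i, v i * oddPrimeFactorCount (p i) := by
  have hq₀ j := (hq j).ne_zero
  have hP := prod_pow_ne_zero hp v Finset.univ
  have hQ := prod_pow_ne_zero hq₀ w Finset.univ
  have h₂ : oddPrimeFactorCount 2 = 0 := by simp [oddPrimeFactorCount_prime Nat.prime_two]
  have h₃ : oddPrimeFactorCount 3 = 0 := by simp [oddPrimeFactorCount_prime Nat.prime_three]
  have h₅ : oddPrimeFactorCount 5 = 0 := by simp [oddPrimeFactorCount_prime Nat.prime_five]
  simp [oddPrimeFactorCount_mul, oddPrimeFactorCount_pow, hP, hQ,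
    oddPrimeFactorCount_prod_pow hp, oddPrimeFactorCount_prod_pow hq₀,
    fun j => oddPrimeFactorCount_inert (hq j) (hinert j), h₂, h₃, h₅]

theorem exists_norm_eq_three_pow_mul {p : ℕ} (hp : p.Prime) (hp2 : p ≠ 2)
    (hsplit : jacobiSym (-15) p = 1) :
    ∃ α : ℤ√(-15), α.norm = (3 ^ oddPrimeFactorCount p : ℕ) * p := by
  have hodd := hp.odd_of_ne_two hp2
  have hmod := (jacobiSym_neg_fifteen_eq_one_iff hodd).1 hsplit
  obtain ⟨α, hα⟩ := exists_norm_eq_or_eq_three_mul hp hp2 hsplit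
  have hα₅ := norm_emod_five α
  refine ⟨α, ?_⟩
  rw [oddPrimeFactorCount_prime hp]
  rcases hα with hα | hα
  · rw [if_neg (by lia), hα, pow_zero, Nat.cast_one, one_mul]
  · rw [if_pos ⟨hodd, by lia⟩, hα, pow_one, Nat.cast_ofNat]

theorem three_pow_dvd_mul_of_dvd_norm {t : ℕ} (ht : t ≤ 1) {z w : ℤ√(-15)}
    (hz : ((3 ^ t : ℕ) : ℤ) ∣ z.norm) (hw : ((3 ^ t : ℕ) : ℤ) ∣ w.norm) :
    (((3 ^ t : ℕ) : ℤ) : ℤ√(-15)) ∣ z * w := by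
  interval_cases t
  · simp
  · exact intCast_dvd_mul_of_dvd_norm Int.prime_three (by norm_num) hz hw

theorem coprime_three_pow_of_jacobiSym_ne_zero {p : ℕ} (hp : p.Prime)
    (h : jacobiSym (-15) p ≠ 0) (k : ℕ) : p.Coprime (3 ^ k) := by
  refine Nat.Coprime.pow_right k ((Nat.coprime_primes hp Nat.prime_three).2 ?_)
  rintro rfl
  exact not_dvd_of_jacobiSym_ne_zero hp h (by norm_num)

theorem normCount_neg_fifteen_split_pow_mul {p : ℕ} (hp : p.Prime) (hp2 : p ≠ 2)
    (hsplit : jacobiSym (-15) p = 1) (k : ℕ) {m : ℕ} (hm : p.Coprime m) :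
    normCount (-15) (p ^ k * m) =
      (k + 1) * normCount (-15) (3 ^ (k * oddPrimeFactorCount p) * m) := by
  have ht : oddPrimeFactorCount p ≤ 1 := by
    rw [oddPrimeFactorCount_prime hp]
    split_ifs <;> simp
  have h₀ : jacobiSym (-15) p ≠ 0 := by norm_num [hsplit]
  obtain ⟨α, hα⟩ := exists_norm_eq_three_pow_mul hp hp2 hsplit
  rw [mul_comm k, pow_mul]
  exact normCount_split_pow_mul (by norm_num) hp hp2 (not_dvd_of_jacobiSym_ne_zero hp h₀)
    (coprime_three_pow_of_jacobiSym_ne_zero hp h₀ _) (normCount_three_pow_sq_mul _) hα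
    (fun w hw => three_pow_dvd_mul_of_dvd_norm ht hw (hα ▸ dvd_mul_right _ _)) k hm

theorem normCount_prod_split_pow_mul {ι : Type*} {p : ι → ℕ} (hp : ∀ i, (p i).Prime)
    (hp_inj : Function.Injective p) (hp2 : ∀ i, p i ≠ 2)
    (hsplit : ∀ i, jacobiSym (-15) (p i) = 1) (v : ι → ℕ) (s : Finset ι) {m : ℕ}
    (hm : ∀ i ∈ s, (p i).Coprime m) :
    normCount (-15) ((∏ i ∈ s, p i ^ v i) * m) =
      (∏ i ∈ s, (1 + v i)) *
        normCount (-15) (3 ^ (∑ i ∈ s, v i * oddPrimeFactorCount (p i)) * m) := by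
  classical
  induction s using Finset.induction_on generalizing m with
  | empty => simp
  | insert i s hi ih =>
    rw [Finset.forall_mem_insert] at hm
    rw [Finset.prod_insert hi, Finset.prod_insert hi, Finset.sum_insert hi, mul_assoc,
      normCount_neg_fifteen_split_pow_mul (hp i) (hp2 i) (hsplit i) _
        ((coprime_prod_pow hp v (hp i) fun j hj h => hi (hp_inj h ▸ hj)).mul_right hm.1),
      mul_left_comm (3 ^ _), ih fun j hj =>
        (coprime_three_pow_of_jacobiSym_ne_zero (hp j) (by norm_num [hsplit]) _).mul_right
          (hm.2 j hj)]
    ring_nf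

theorem normCount_factored {ι κ : Type*} [Fintype ι] [Fintype κ] {p : ι → ℕ} {q : κ → ℕ}
    (hp : ∀ i, (p i).Prime) (hp_inj : Function.Injective p) (hp2 : ∀ i, p i ≠ 2)
    (hsplit : ∀ i, jacobiSym (-15) (p i) = 1) (hq : ∀ j, (q j).Prime)
    (hq_inj : Function.Injective q) (hq2 : ∀ j, q j ≠ 2)
    (hinert : ∀ j, jacobiSym (-15) (q j) = -1) (a b c : ℕ) (v : ι → ℕ) (w : κ → ℕ) :
    (normCount (-15) (2 ^ a * 3 ^ b * 5 ^ c * (∏ i, p i ^ v i) * ∏ j, q j ^ w j) : ℚ) =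
      |(a : ℚ) - 1| * (1 + (-1 : ℚ) ^ (a + b + c + ∑ i, v i * oddPrimeFactorCount (p i))) *
        (∏ i, (1 + (v i : ℚ))) * ∏ j, ((1 + (-1 : ℚ) ^ w j) / 2) := by
  set P := ∏ i, p i ^ v i with hP
  set Q := ∏ j, q j ^ w j with hQ
  have hodd : Odd (3 ^ b * 5 ^ c * P * Q) :=
    (((Odd.pow (by decide)).mul (Odd.pow (by decide))).mul
      (odd_prod_pow (fun i => (hp i).odd_of_ne_two (hp2 i)) v _)).mul
      (odd_prod_pow (fun j => (hq j).odd_of_ne_two (hq2 j)) w _)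
  have hQcop : ∀ j ∈ Finset.univ, (q j).Coprime (P * 3 ^ (a + b + c)) := fun j _ => by
    refine (coprime_prod_pow hp v (hq j) fun i _ h => ?_).mul_right
      (coprime_three_pow_of_jacobiSym_ne_zero (hq j) (by norm_num [hinert]) _)
    have := hinert j
    rw [h, hsplit i] at this
    norm_num at this
  calc (normCount (-15) (2 ^ a * 3 ^ b * 5 ^ c * P * Q) : ℚ)
      = |(a : ℚ) - 1| * normCount (-15) (3 ^ a * (3 ^ b * 5 ^ c * P * Q)) := by
        rw [← normCount_two_pow_mul a hodd]
        congr 2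
        ring
    _ = |(a : ℚ) - 1| * normCount (-15) (Q * (P * 3 ^ (a + b + c))) := by
        rw [show 3 ^ a * (3 ^ b * 5 ^ c * P * Q) = 5 ^ c * (3 ^ (a + b) * P * Q) by ring,
          normCount_five_pow_mul]
        congr 3
        ring
    _ = _ := by
        rw [hQ, normCount_prod_inert_pow_mul hq hq_inj hinert w _ hQcop, hP,
          normCount_prod_split_pow_mul hp hp_inj hp2 hsplit v _ fun i _ =>
            coprime_three_pow_of_jacobiSym_ne_zero (hp i) (by norm_num [hsplit]) _,
          ← pow_add, Nat.cast_mul, normCount_three_pow, add_comm (∑ i, _)]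
        push_cast
        ring

theorem corollary5p2
    (n a b c r s : ℕ) (p v : Fin r → ℕ) (q w : Fin s → ℕ)
    (hp : ∀ i, (p i).Prime) (hp_inj : Function.Injective p)
    (hp_class : ∀ i, p i % 15 = 1 ∨ p i % 15 = 2 ∨ p i % 15 = 4 ∨ p i % 15 = 8)
    (hp_two : ∀ i, p i ≠ 2)
    (hq : ∀ j, (q j).Prime) (hq_inj : Function.Injective q)
    (hq_class : ∀ j, q j % 15 = 7 ∨ q j % 15 = 11 ∨ q j % 15 = 13 ∨ q j % 15 = 14)
    (hn : n = 2 ^ a * 3 ^ b * 5 ^ c * (∏ i, p i ^ v i) * ∏ j, q j ^ w j) :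
    (numDiagReps 1 15 n : ℚ) =
        |(a : ℚ) - 1| * (1 + (-1 : ℚ) ^ (a + b + c + oddPrimeFactorCount n)) *
          (∏ i, (1 + (v i : ℚ))) * ∏ j, ((1 + (-1 : ℚ) ^ w j) / 2) ∧
      (numDiagReps 3 5 n : ℚ) =
        |(a : ℚ) - 1| * (1 - (-1 : ℚ) ^ (a + b + c + oddPrimeFactorCount n)) *
          (∏ i, (1 + (v i : ℚ))) * ∏ j, ((1 + (-1 : ℚ) ^ w j) / 2) := by
  have hq_two : ∀ j, q j ≠ 2 := fun j hj => by simpa [hj] using hq_class j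
  have hsplit i := (jacobiSym_neg_fifteen_eq_one_iff ((hp i).odd_of_ne_two (hp_two i))).2
    (hp_class i)
  have hinert j := (jacobiSym_neg_fifteen_eq_neg_one_iff ((hq j).odd_of_ne_two (hq_two j))).2
    (hq_class j)
  have hcount b := normCount_factored hp hp_inj hp_two hsplit hq hq_inj hq_two hinert a b c v w
  have h3n : 3 * n = 2 ^ a * 3 ^ (b + 1) * 5 ^ c * (∏ i, p i ^ v i) * ∏ j, q j ^ w j := by
    rw [hn]
    ring
  have ht : oddPrimeFactorCount n = ∑ i, v i * oddPrimeFactorCount (p i) :=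
    hn ▸ oddPrimeFactorCount_factored (fun i => (hp i).ne_zero) hq hinert a b c v w
  rw [numDiagReps_one_fifteen, numDiagReps_three_five, ht, h3n, hcount (b + 1), hn, hcount b]
  refine ⟨rfl, ?_⟩
  ring
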